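/- **Theorem 3.1 (Monotonicity).** Let $D\subset\mathbb R^d$ be a bounded open set and let $$X=\{w\in H^1_0(D)\ :\ w\ge 0\ \text{a.e. in } D,\ 1+\Delta w\ge 0\ \text{in the sense of distributions on } D\}\subseteq L^2(D),$$ endowed with the distance of $L^2(D)$. Let $J:X\to\,]-\infty,+\infty]$ be proper (not identically $+\infty$) and decreasing, in the sense that for all $w_1,w_2\in X$ $$w_1\le w_2\ \text{a.e. in } D\ \Longrightarrow\ J(w_1)\ge J(w_2).$$ Let $w_0\in X$, and let $w:[0,T]\to X$ be a generalized minimizing movement of $J$ with initial condition $w_0$ with respect to the $L^2(D)$ distance; that is, there are time steps $\varepsilon_k>0$, $\varepsilon_k\to0$, and for each $k$ a sequence $(w_k^n)_{n\ge0}$ in $X$ with $$w_k^0=w_0,\qquad w_k^{n+1}\in\operatorname*{argmin}_{v\in X}\Big\{J(v)+\frac1{2\varepsilon_k}\int_D|v-w_k^n|^2\,dx\Big\}\quad\text{for all } n\ge 0,$$ such that $w_k^{\lfloor t/\varepsilon_k\rfloor}\to w(t)$ in $L^2(D)$ as $k\to\infty$ for every $t\in[0,T]$. Then $w$ is increasing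 in time, in the sense that for all $t_1,t_2\in[0,T]$ $$t_1<t_2\ \Longrightarrow\ w(t_1)\le w(t_2)\ \text{a.e. in } D.$$ -/

import Mathlib

open MeasureTheory Filter Topology
open scoped Distributions

/-- The vector field `G` is the weak (distributional) gradient of `u` on the open set `D`, both `u`
and `G` being square integrable on `D`; thus `u ∈ H¹(D)` with `∇u = G`. Here `𝓓(D, ℝ)` is
Mathlib's space of smooth functions with compact support contained in `D`. -/
def HasSobolevGradient {d : ℕ} (D : TopologicalSpace.Opens (EuclideanSpace ℝ (Fin d)))
    (u : EuclideanSpace ℝ (Fin d) → ℝ)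
    (G : EuclideanSpace ℝ (Fin d) → EuclideanSpace ℝ (Fin d)) : Prop :=
  MemLp u 2 (volume.restrict (D : Set (EuclideanSpace ℝ (Fin d)))) ∧
  MemLp G 2 (volume.restrict (D : Set (EuclideanSpace ℝ (Fin d)))) ∧
  ∀ φ : 𝓓(D, ℝ),
    ∫ x in (D : Set (EuclideanSpace ℝ (Fin d))), u x • gradient φ x =
      - ∫ x in (D : Set (EuclideanSpace ℝ (Fin d))), φ x • G x

/-- `u ∈ H¹₀(D)`: `u` belongs to `H¹(D)` and is the limit, in the norm of `H¹(D)`, of smooth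
functions with compact support in `D`. -/
def MemH10 {d : ℕ} (D : TopologicalSpace.Opens (EuclideanSpace ℝ (Fin d)))
    (u : EuclideanSpace ℝ (Fin d) → ℝ) : Prop :=
  ∃ G : EuclideanSpace ℝ (Fin d) → EuclideanSpace ℝ (Fin d),
    HasSobolevGradient D u G ∧
    ∃ φ : ℕ → 𝓓(D, ℝ),
      Tendsto (fun n => eLpNorm (fun x => φ n x - u x) 2
        (volume.restrict (D : Set (EuclideanSpace ℝ (Fin d))))) atTop (𝓝 0) ∧
      Tendsto (fun n => eLpNorm (fun x => gradient (φ n) x - G x) 2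
        (volume.restrict (D : Set (EuclideanSpace ℝ (Fin d))))) atTop (𝓝 0)

/-- `1 + Δu ≥ 0` on `D` in the sense of distributions, for `u ∈ H¹(D)`: the distribution
`1 + Δu` acts on a test function `φ` as `∫_D φ - ∫_D ∇u · ∇φ`, and this has to be nonnegative for
all nonnegative `φ`. -/
def OneAddLaplacianNonneg {d : ℕ} (D : TopologicalSpace.Opens (EuclideanSpace ℝ (Fin d)))
    (u : EuclideanSpace ℝ (Fin d) → ℝ) : Prop :=
  ∃ G : EuclideanSpace ℝ (Fin d) → EuclideanSpace ℝ (Fin d),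
    HasSobolevGradient D u G ∧
    ∀ φ : 𝓓(D, ℝ), (∀ x, 0 ≤ φ x) →
      0 ≤ (∫ x in (D : Set (EuclideanSpace ℝ (Fin d))), φ x) -
        ∫ x in (D : Set (EuclideanSpace ℝ (Fin d))), inner ℝ (G x) (gradient φ x)

/-- The set `X = {w ∈ H¹₀(D) : w ≥ 0, 1 + Δw ≥ 0}`, as a subset of `L²(D)`. As a subtype it
carries the distance of `L²(D)`. -/
def admissibleSet {d : ℕ} (D : TopologicalSpace.Opens (EuclideanSpace ℝ (Fin d))) :
    Set (Lp ℝ 2 (volume.restrict (D : Set (EuclideanSpace ℝ (Fin d))))) :=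
  {w | MemH10 D w ∧
    (∀ᵐ x ∂(volume.restrict (D : Set (EuclideanSpace ℝ (Fin d)))), 0 ≤ w x) ∧
    OneAddLaplacianNonneg D w}

/-- `w` is a solution of the implicit Euler scheme for `F` with time step `ε` and initial
condition `u₀`: `w 0 = u₀` and `w (n + 1)` minimizes `v ↦ F v + d(v, w n)² / (2ε)`. -/
def IsEulerScheme {M : Type*} [MetricSpace M] (F : M → EReal) (ε : ℝ) (u₀ : M) (w : ℕ → M) :
    Prop :=
  w 0 = u₀ ∧
  ∀ n : ℕ, ∀ v : M,
    F (w (n + 1)) + ((dist (w (n + 1)) (w n) ^ 2 / (2 * ε) : ℝ) : EReal) ≤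
      F v + ((dist v (w n) ^ 2 / (2 * ε) : ℝ) : EReal)

/-- The set of generalized minimizing movements `u : [0, T] → M` of `F` with initial condition
`u₀`, for the topology of the distance: along some sequence of time steps `ε k → 0`, the piecewise
constant discrete solutions `t ↦ w k ⌊t / ε k⌋` converge to `u t` for every `t ∈ [0, T]`. -/
def GMM {M : Type*} [MetricSpace M] (F : M → EReal) (u₀ : M) (T : ℝ) :
    Set (Set.Icc (0 : ℝ) T → M) :=
  {u | ∃ ε : ℕ → ℝ, (∀ k, 0 < ε k) ∧ Tendsto ε atTop (𝓝 0) ∧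
    ∃ w : ℕ → ℕ → M, (∀ k, IsEulerScheme F (ε k) u₀ (w k)) ∧
      ∀ t : Set.Icc (0 : ℝ) T,
        Tendsto (fun k => w k ⌊(t : ℝ) / ε k⌋₊) atTop (𝓝 (u t))}

/-! The scheme can never step down. Let `s` be the maximum of `w n` and `w (n + 1)`. As `J`
decreases, `J s ≤ J (w (n + 1))`, so minimality of `w (n + 1)` forces it to be no farther from `w n`
than `s` is. But `s - w n` and `s - w (n + 1)` are the positive and negative parts of `w (n + 1) - w
n`, which are orthogonal in L², so Pythagoras leaves only `s = w (n + 1)`, i.e. `w n ≤ w (n + 1)`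
(`le_of_dist_le_dist_sup`, `IsEulerScheme.monotone`). The order survives L² limits.

The analytic part is that `s` is admissible (`sup_mem_admissibleSet`). Smooth approximations of the
positive part give ∇max(u,v) = ∇v + 1_{u>v} ∇(u-v) (`H10Pair.max`). For 1 + Δ max(u,v) ≥ 0, split a
test function φ ≥ 0 into φ p(u-v) and φ (1 - p(u-v)), with p a smooth increasing step; use the first
in the inequality for u, the second in that for v, and add. The extra term φ p'(u-v) |∇(u-v)|² is
nonnegative and can be dropped (`OneAddDivNonneg.interpolate`). Letting p tend to the indicator of
(0,∞) yields `OneAddDivNonneg.max`. -/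

/-! ### Limits and bilinear pairings in L². -/

section LpLimits

variable {α F F' W : Type*} [MeasurableSpace α] {μ : Measure α}
  [NormedAddCommGroup F] [NormedAddCommGroup F'] [NormedAddCommGroup W]

/-- Dominated convergence in `L²`. -/
theorem tendsto_eLpNorm_two_sub_of_dominated {h : ℕ → α → F} {h' : α → F} {g : α → F'}
    (hh : ∀ n, AEStronglyMeasurable (h n) μ) (hg : MemLp g 2 μ)
    (hb : ∀ n x, ‖h n x‖ ≤ ‖g x‖) (hlim : ∀ᵐ x ∂μ, Tendsto (fun n => h n x) atTop (𝓝 (h' x))) :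
    Tendsto (fun n => eLpNorm (fun x => h n x - h' x) 2 μ) atTop (𝓝 0) := by
  have hh' : AEStronglyMeasurable h' μ := aestronglyMeasurable_of_tendsto_ae atTop hh hlim
  have key : Tendsto (fun n => ∫⁻ x, ‖h n x - h' x‖ₑ ^ (2 : ℝ) ∂μ) atTop (𝓝 0) := by
    have h0 : (∫⁻ _, 0 ∂μ) = 0 := lintegral_zero
    rw [← h0]
    refine tendsto_lintegral_of_dominated_convergence' (fun x => (2 * ‖g x‖ₑ) ^ (2 : ℝ)) ?_ ?_ ?_ ?_
    · exact fun n => ((hh n).sub hh').enorm.pow_const _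
    · intro n
      filter_upwards [hlim] with x hx
      have h1 : ‖h' x‖ ≤ ‖g x‖ := le_of_tendsto hx.norm (Eventually.of_forall fun n => hb n x)
      refine ENNReal.rpow_le_rpow ?_ (by norm_num)
      calc ‖h n x - h' x‖ₑ ≤ ‖h n x‖ₑ + ‖h' x‖ₑ := enorm_sub_le
        _ ≤ ‖g x‖ₑ + ‖g x‖ₑ :=
          add_le_add (enorm_le_iff_norm_le.2 (hb n x)) (enorm_le_iff_norm_le.2 h1)
        _ = 2 * ‖g x‖ₑ := (two_mul _).symm
    · have h2 : eLpNorm g 2 μ < ⊤ := hg.eLpNorm_lt_top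
      have h3 := lintegral_rpow_enorm_lt_top_of_eLpNorm_lt_top (by norm_num) (by norm_num) h2
      simp_rw [ENNReal.mul_rpow_of_nonneg _ _ (zero_le_two : (0 : ℝ) ≤ 2)]
      rw [lintegral_const_mul' _ _ (by norm_num)]
      exact ENNReal.mul_ne_top (by norm_num) (by simpa using h3.ne)
    · filter_upwards [hlim] with x hx
      have : Tendsto (fun n => ‖h n x - h' x‖ₑ) atTop (𝓝 0) := by
        simpa using (hx.sub_const (h' x)).enorm
      simpa using this.ennrpow_const 2
  have := key.ennrpow_const (1 / 2)
  simpa [eLpNorm_eq_lintegral_rpow_enorm_toReal (μ := μ) (p := 2) two_ne_zero ENNReal.ofNat_ne_top] using this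

variable [NormedSpace ℝ F] [NormedSpace ℝ F'] [NormedSpace ℝ W]

theorem MeasureTheory.MemLp.integrable_bilin (B : F →L[ℝ] F' →L[ℝ] W) {f : α → F} {g : α → F'}
    (hf : MemLp f 2 μ) (hg : MemLp g 2 μ) : Integrable (fun x => B (f x) (g x)) μ :=
  memLp_one_iff_integrable.1 (B.memLp_of_bilin 1 hf hg)

theorem tendsto_integral_bilin (B : F →L[ℝ] F' →L[ℝ] W) {f : ℕ → α → F} {f' : α → F} {g : α → F'}
    (hf : ∀ n, MemLp (f n) 2 μ) (hf' : MemLp f' 2 μ) (hg : MemLp g 2 μ)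
    (hlim : Tendsto (fun n => eLpNorm (fun x => f n x - f' x) 2 μ) atTop (𝓝 0)) :
    Tendsto (fun n => ∫ x, B (f n x) (g x) ∂μ) atTop (𝓝 (∫ x, B (f' x) (g x) ∂μ)) := by
  refine tendsto_integral_of_L1' _ (hf'.integrable_bilin B hg).aestronglyMeasurable
    (Eventually.of_forall fun n => (hf n).integrable_bilin B hg) ?_
  have hle : ∀ n, eLpNorm ((fun x => B (f n x) (g x)) - fun x => B (f' x) (g x)) 1 μ ≤
      ‖B‖₊ * eLpNorm (fun x => f n x - f' x) 2 μ * eLpNorm g 2 μ := by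
    intro n
    have : ((fun x => B (f n x) (g x)) - fun x => B (f' x) (g x)) =
        fun x => B (f n x - f' x) (g x) := by
      ext x; simp
    rw [this]
    exact eLpNorm_le_eLpNorm_mul_eLpNorm_of_nnnorm ((hf n).sub hf').1 hg.1 (B · ·) ‖B‖₊
      (Eventually.of_forall fun x => B.le_opNorm₂ _ _)
  refine tendsto_of_tendsto_of_tendsto_of_le_of_le tendsto_const_nhds ?_ (fun _ => zero_le) hle
  have h1 := ENNReal.Tendsto.const_mul (a := (‖B‖₊ : ENNReal)) hlim (Or.inr ENNReal.coe_ne_top)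
  have h2 := ENNReal.Tendsto.mul_const (b := eLpNorm g 2 μ) h1 (Or.inr hg.eLpNorm_ne_top)
  simpa using h2

end LpLimits

/-! ### Smooth approximations of the indicator of (0,∞) and of the positive part. -/

section SmoothStep

open scoped ContDiff

/-- Smooth increasing steps approximating the indicator function of `(0, ∞)`. -/
noncomputable def smoothStep (k : ℕ) (t : ℝ) : ℝ := Real.smoothTransition ((k + 1) * t)

theorem contDiff_smoothStep (k : ℕ) : ContDiff ℝ ∞ (smoothStep k) :=
  Real.smoothTransition.contDiff.comp (contDiff_const.mul contDiff_id)

theorem smoothStep_nonneg (k : ℕ) (t : ℝ) : 0 ≤ smoothStep k t := Real.smoothTransition.nonneg _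

theorem smoothStep_le_one (k : ℕ) (t : ℝ) : smoothStep k t ≤ 1 := Real.smoothTransition.le_one _

theorem norm_smoothStep_le_one (k : ℕ) (t : ℝ) : ‖smoothStep k t‖ ≤ 1 := by
  rw [Real.norm_of_nonneg (smoothStep_nonneg k t)]
  exact smoothStep_le_one k t

theorem smoothStep_of_nonpos (k : ℕ) {t : ℝ} (ht : t ≤ 0) : smoothStep k t = 0 :=
  Real.smoothTransition.zero_of_nonpos (mul_nonpos_of_nonneg_of_nonpos (by positivity) ht)

theorem smoothStep_of_one_le (k : ℕ) {t : ℝ} (ht : 1 ≤ t) : smoothStep k t = 1 :=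
  Real.smoothTransition.one_of_one_le (by nlinarith [(Nat.cast_nonneg k : (0 : ℝ) ≤ k)])

theorem monotone_smoothStep (k : ℕ) : Monotone (smoothStep k) := fun _ _ h =>
  Real.smoothTransition.monotone (mul_le_mul_of_nonneg_left h (by positivity))

/-- Every step vanishes at `0`, so the convergence holds at every point, and the set {u = v} needs
no separate argument later. -/
theorem tendsto_smoothStep (t : ℝ) :
    Tendsto (fun k => smoothStep k t) atTop (𝓝 (if 0 < t then 1 else 0)) := by
  split_ifs with ht
  · obtain ⟨N, hN⟩ := exists_nat_ge (1 / t)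
    refine tendsto_const_nhds.congr' ?_
    filter_upwards [eventually_ge_atTop N] with k hk
    refine (Real.smoothTransition.one_of_one_le ?_).symm
    have : (N : ℝ) ≤ k := by exact_mod_cast hk
    rw [div_le_iff₀ ht] at hN
    nlinarith
  · simp [smoothStep_of_nonpos _ (not_lt.1 ht)]

/-- The step is constant outside [0,1], so its derivative is continuous with compact support. The
bound may depend on `k`: it serves only in a limit taken with `k` fixed. -/
theorem exists_deriv_smoothStep_le (k : ℕ) : ∃ C, ∀ t, ‖deriv (smoothStep k) t‖ ≤ C := by
  have hc : HasCompactSupport (deriv (smoothStep k)) := by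
    refine HasCompactSupport.intro (isCompact_Icc (a := (0 : ℝ)) (b := 1)) fun t ht => ?_
    rcases lt_or_ge t 0 with h | h
    · have : smoothStep k =ᶠ[𝓝 t] fun _ => 0 := by
        filter_upwards [Iio_mem_nhds h] with s hs using smoothStep_of_nonpos k (le_of_lt hs)
      rw [this.deriv_eq, deriv_const]
    · have h1 : 1 < t := by
        by_contra hcon
        exact ht ⟨h, not_lt.1 hcon⟩
      have : smoothStep k =ᶠ[𝓝 t] fun _ => 1 := by
        filter_upwards [Ioi_mem_nhds h1] with s hs using smoothStep_of_one_le k (le_of_lt hs)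
      rw [this.deriv_eq, deriv_const]
  exact ((contDiff_smoothStep k).continuous_deriv (by simp)).bounded_above_of_compact_support hc

/-- Smooth approximations of the positive part. -/
noncomputable def smoothPosPart (k : ℕ) (t : ℝ) : ℝ := ∫ s in (0 : ℝ)..t, smoothStep k s

theorem hasDerivAt_smoothPosPart (k : ℕ) (t : ℝ) :
    HasDerivAt (smoothPosPart k) (smoothStep k t) t :=
  (contDiff_smoothStep k).continuous.integral_hasStrictDerivAt 0 t |>.hasDerivAt

theorem deriv_smoothPosPart (k : ℕ) : deriv (smoothPosPart k) = smoothStep k :=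
  funext fun t => (hasDerivAt_smoothPosPart k t).deriv

theorem contDiff_smoothPosPart (k : ℕ) : ContDiff ℝ ∞ (smoothPosPart k) := by
  rw [contDiff_infty_iff_deriv, deriv_smoothPosPart]
  exact ⟨fun t => (hasDerivAt_smoothPosPart k t).differentiableAt, contDiff_smoothStep k⟩

theorem smoothPosPart_zero (k : ℕ) : smoothPosPart k 0 = 0 := intervalIntegral.integral_same

theorem norm_sub_le_of_norm_deriv_le_one {f : ℝ → ℝ} (hf : Differentiable ℝ f)
    (h1 : ∀ t, ‖deriv f t‖ ≤ 1) (s t : ℝ) : ‖f s - f t‖ ≤ ‖s - t‖ := by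
  simpa using Convex.norm_image_sub_le_of_norm_deriv_le (𝕜 := ℝ) (fun x _ => hf x)
    (fun x _ => h1 x) convex_univ (Set.mem_univ t) (Set.mem_univ s)

theorem tendsto_smoothPosPart (t : ℝ) :
    Tendsto (fun k => smoothPosPart k t) atTop (𝓝 (max t 0)) := by
  have h : max t 0 = ∫ s in (0 : ℝ)..t, if 0 < s then (1 : ℝ) else 0 := by
    rcases le_total t 0 with ht | ht
    · rw [max_eq_right ht, intervalIntegral.integral_symm, intervalIntegral.integral_of_le ht,
        setIntegral_congr_fun measurableSet_Ioc (g := fun _ => 0)]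
      · simp
      · intro s hs
        simp [hs.2]
    · rw [max_eq_left ht, intervalIntegral.integral_of_le ht,
        setIntegral_congr_fun measurableSet_Ioc (g := fun _ => 1)]
      · simp [ht]
      · intro s hs
        simp [hs.1]
  rw [h]
  refine intervalIntegral.tendsto_integral_filter_of_dominated_convergence (fun _ => 1) ?_ ?_ ?_ ?_
  · exact Eventually.of_forall fun k =>
      (contDiff_smoothStep k).continuous.aestronglyMeasurable
  · exact Eventually.of_forall fun k => Eventually.of_forall fun s _ => norm_smoothStep_le_one k s
  · exact intervalIntegrable_const
  · exact Eventually.of_forall fun s _ => tendsto_smoothStep s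

end SmoothStep

/-! ### Stability of L² convergence. -/

section L2Tendsto

variable {α F : Type*} [MeasurableSpace α] {μ : Measure α} [NormedAddCommGroup F]

theorem tendsto_eLpNorm_two_sub_trans {f g : ℕ → α → F} {h : α → F}
    (hf : ∀ n, MemLp (f n) 2 μ) (hg : ∀ n, MemLp (g n) 2 μ) (hh : MemLp h 2 μ)
    (hfg : Tendsto (fun n => eLpNorm (fun x => f n x - g n x) 2 μ) atTop (𝓝 0))
    (hgh : Tendsto (fun n => eLpNorm (fun x => g n x - h x) 2 μ) atTop (𝓝 0)) :
    Tendsto (fun n => eLpNorm (fun x => f n x - h x) 2 μ) atTop (𝓝 0) := by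
  refine tendsto_of_tendsto_of_tendsto_of_le_of_le tendsto_const_nhds
    (by simpa using hfg.add hgh) (fun _ => zero_le) fun n => ?_
  have : (fun x => f n x - h x) = (fun x => f n x - g n x) + fun x => g n x - h x := by
    ext x; simp
  rw [this]
  exact eLpNorm_add_le ((hf n).sub (hg n)).1 ((hg n).sub hh).1 one_le_two

theorem tendsto_eLpNorm_two_sub_add {f g : ℕ → α → F} {f' g' : α → F}
    (hf : ∀ n, MemLp (f n) 2 μ) (hg : ∀ n, MemLp (g n) 2 μ) (hf' : MemLp f' 2 μ)
    (hg' : MemLp g' 2 μ)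
    (hff : Tendsto (fun n => eLpNorm (fun x => f n x - f' x) 2 μ) atTop (𝓝 0))
    (hgg : Tendsto (fun n => eLpNorm (fun x => g n x - g' x) 2 μ) atTop (𝓝 0)) :
    Tendsto (fun n => eLpNorm (fun x => (f n x + g n x) - (f' x + g' x)) 2 μ) atTop (𝓝 0) := by
  refine tendsto_of_tendsto_of_tendsto_of_le_of_le tendsto_const_nhds
    (by simpa using hff.add hgg) (fun _ => zero_le) fun n => ?_
  have : (fun x => (f n x + g n x) - (f' x + g' x)) =
      (fun x => f n x - f' x) + fun x => g n x - g' x := by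
    ext x; simp only [Pi.add_apply]; abel
  rw [this]
  exact eLpNorm_add_le ((hf n).sub hf').1 ((hg n).sub hg').1 one_le_two

/-- Multiplication by uniformly bounded functions preserves convergence to `0` in `L²`. -/
theorem tendsto_eLpNorm_two_of_norm_le_mul {F' : Type*} [NormedAddCommGroup F'] {f : ℕ → α → F}
    {g : ℕ → α → F'} {C : ℝ} (hfg : ∀ n x, ‖f n x‖ ≤ C * ‖g n x‖)
    (hg : Tendsto (fun n => eLpNorm (g n) 2 μ) atTop (𝓝 0)) :
    Tendsto (fun n => eLpNorm (f n) 2 μ) atTop (𝓝 0) := by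
  refine tendsto_of_tendsto_of_tendsto_of_le_of_le tendsto_const_nhds ?_ (fun _ => zero_le)
    fun n => eLpNorm_le_mul_eLpNorm_of_ae_le_mul (Eventually.of_forall (hfg n)) 2
  simpa using ENNReal.Tendsto.const_mul hg (Or.inr ENNReal.ofReal_ne_top)

end L2Tendsto

/-! ### Calculus rules for the gradient. -/

section Gradient

variable {F : Type*} [NormedAddCommGroup F] [InnerProductSpace ℝ F] [CompleteSpace F]

theorem gradient_add_apply {f g : F → ℝ} {x : F} (hf : DifferentiableAt ℝ f x)
    (hg : DifferentiableAt ℝ g x) :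
    gradient (fun y => f y + g y) x = gradient f x + gradient g x := by
  simp [gradient, fderiv_fun_add hf hg]

theorem gradient_sub_apply {f g : F → ℝ} {x : F} (hf : DifferentiableAt ℝ f x)
    (hg : DifferentiableAt ℝ g x) :
    gradient (fun y => f y - g y) x = gradient f x - gradient g x := by
  simp [gradient, fderiv_fun_sub hf hg]

theorem gradient_mul_apply {f g : F → ℝ} {x : F} (hf : DifferentiableAt ℝ f x)
    (hg : DifferentiableAt ℝ g x) :
    gradient (fun y => f y * g y) x = f x • gradient g x + g x • gradient f x := by
  simp [gradient, fderiv_fun_mul hf hg]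

theorem gradient_comp_apply {f : ℝ → ℝ} {g : F → ℝ} {x : F} (hf : DifferentiableAt ℝ f (g x))
    (hg : DifferentiableAt ℝ g x) :
    gradient (fun y => f (g y)) x = deriv f (g x) • gradient g x := by
  have h := (hf.hasDerivAt.comp_hasFDerivAt x hg.hasFDerivAt).fderiv
  simp only [gradient]
  rw [show (fun y => f (g y)) = f ∘ g from rfl, h, map_smul]

theorem inner_gradient_eq_fderiv (f : F → ℝ) (x v : F) :
    inner ℝ (gradient f x) v = fderiv ℝ f x v := by
  rw [gradient, InnerProductSpace.toDual_symm_apply]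

end Gradient

/-! ### Test functions and the lattice structure of H¹₀(D). -/

section Sobolev

variable {d : ℕ} {D : TopologicalSpace.Opens (EuclideanSpace ℝ (Fin d))}

/-- Lebesgue measure on the open set `D`. -/
noncomputable abbrev TopologicalSpace.Opens.vol
    (D : TopologicalSpace.Opens (EuclideanSpace ℝ (Fin d))) :
    Measure (EuclideanSpace ℝ (Fin d)) :=
  volume.restrict (D : Set (EuclideanSpace ℝ (Fin d)))

namespace TestFunction

open scoped ContDiff

theorem differentiable (φ : 𝓓(D, ℝ)) : Differentiable ℝ φ :=
  φ.contDiff.differentiable (by simp)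

theorem continuous_gradient (φ : 𝓓(D, ℝ)) : Continuous (gradient φ) :=
  (InnerProductSpace.toDual ℝ _).symm.continuous.comp (φ.contDiff.continuous_fderiv (by simp))

theorem hasCompactSupport_gradient (φ : 𝓓(D, ℝ)) : HasCompactSupport (gradient φ) :=
  (φ.hasCompactSupport.fderiv ℝ).comp_left
    (g := (InnerProductSpace.toDual ℝ (EuclideanSpace ℝ (Fin d))).symm) (map_zero _)

theorem memLp_two (φ : 𝓓(D, ℝ)) : MemLp φ 2 D.vol :=
  (φ.continuous.memLp_of_hasCompactSupport φ.hasCompactSupport).restrict _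

theorem memLp_two_gradient (φ : 𝓓(D, ℝ)) : MemLp (gradient φ) 2 D.vol :=
  (φ.continuous_gradient.memLp_of_hasCompactSupport φ.hasCompactSupport_gradient).restrict _

/-- Composition of a test function with a smooth function vanishing at `0`. -/
noncomputable def smoothComp (f : ℝ → ℝ) (hf : ContDiff ℝ ∞ f) (h0 : f 0 = 0) (φ : 𝓓(D, ℝ)) : 𝓓(D, ℝ) where
  toFun x := f (φ x)
  contDiff' := hf.comp φ.contDiff
  hasCompactSupport' := φ.hasCompactSupport.comp_left h0
  tsupport_subset' := (tsupport_comp_subset h0 φ).trans φ.tsupport_subset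

@[simp]
theorem smoothComp_apply (f : ℝ → ℝ) (hf : ContDiff ℝ ∞ f) (h0 : f 0 = 0) (φ : 𝓓(D, ℝ))
    (x : EuclideanSpace ℝ (Fin d)) : smoothComp f hf h0 φ x = f (φ x) := rfl

theorem gradient_smoothComp (f : ℝ → ℝ) (hf : ContDiff ℝ ∞ f) (h0 : f 0 = 0) (φ : 𝓓(D, ℝ))
    (x : EuclideanSpace ℝ (Fin d)) :
    gradient (smoothComp f hf h0 φ) x = deriv f (φ x) • gradient φ x :=
  gradient_comp_apply (hf.differentiable (by simp) _) (φ.differentiable x)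

/-- Product of a test function with a smooth function. -/
noncomputable def mulSmooth (φ : 𝓓(D, ℝ)) (g : EuclideanSpace ℝ (Fin d) → ℝ) (hg : ContDiff ℝ ∞ g) :
    𝓓(D, ℝ) where
  toFun x := φ x * g x
  contDiff' := φ.contDiff.mul hg
  hasCompactSupport' := φ.hasCompactSupport.mul_right
  tsupport_subset' := (tsupport_mul_subset_left).trans φ.tsupport_subset

@[simp]
theorem mulSmooth_apply (φ : 𝓓(D, ℝ)) (g : EuclideanSpace ℝ (Fin d) → ℝ) (hg : ContDiff ℝ ∞ g)
    (x : EuclideanSpace ℝ (Fin d)) : φ.mulSmooth g hg x = φ x * g x := rfl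

theorem gradient_mulSmooth (φ : 𝓓(D, ℝ)) (g : EuclideanSpace ℝ (Fin d) → ℝ) (hg : ContDiff ℝ ∞ g)
    (x : EuclideanSpace ℝ (Fin d)) :
    gradient (φ.mulSmooth g hg) x = φ x • gradient g x + g x • gradient φ x :=
  gradient_mul_apply (φ.differentiable x) (hg.differentiable (by simp) x)

theorem gradient_add (φ ψ : 𝓓(D, ℝ)) (x : EuclideanSpace ℝ (Fin d)) :
    gradient (φ + ψ : 𝓓(D, ℝ)) x = gradient φ x + gradient ψ x :=
  gradient_add_apply (φ.differentiable x) (ψ.differentiable x)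

theorem gradient_sub (φ ψ : 𝓓(D, ℝ)) (x : EuclideanSpace ℝ (Fin d)) :
    gradient (φ - ψ : 𝓓(D, ℝ)) x = gradient φ x - gradient ψ x :=
  gradient_sub_apply (φ.differentiable x) (ψ.differentiable x)

theorem integral_smul_gradient (φ ψ : 𝓓(D, ℝ)) :
    ∫ x, φ x • gradient ψ x ∂D.vol = - ∫ x, ψ x • gradient φ x ∂D.vol := by
  have hint : ∀ f g : 𝓓(D, ℝ), Integrable (fun x => f x • gradient g x) D.vol := fun f g =>
    f.memLp_two.integrable_bilin (ContinuousLinearMap.lsmul ℝ ℝ) g.memLp_two_gradient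
  -- Pairing with a fixed vector reduces the claim to scalar integration by parts for a directional
  -- derivative on the whole space.
  refine ext_inner_left ℝ fun v => ?_
  rw [inner_neg_right, ← integral_inner (hint φ ψ), ← integral_inner (hint ψ φ)]
  have key : ∀ f g : 𝓓(D, ℝ), ∀ x, inner ℝ v (f x • gradient g x) = f x * fderiv ℝ g x v := by
    intro f g x
    rw [inner_smul_right, real_inner_comm, inner_gradient_eq_fderiv]
  have hfull : ∀ f g : 𝓓(D, ℝ),
      ∫ x, f x * fderiv ℝ g x v ∂D.vol = ∫ x, f x * fderiv ℝ g x v := by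
    intro f g
    refine setIntegral_eq_integral_of_forall_compl_eq_zero fun x hx => ?_
    rw [image_eq_zero_of_notMem_tsupport fun h => hx (f.tsupport_subset h), zero_mul]
  have hi : ∀ f g : 𝓓(D, ℝ), Integrable (fun x => f x * fderiv ℝ g x v) := by
    intro f g
    refine Continuous.integrable_of_hasCompactSupport ?_ f.hasCompactSupport.mul_right
    exact f.continuous.mul ((g.contDiff.continuous_fderiv (by simp)).clm_apply continuous_const)
  simp_rw [key, hfull]
  rw [integral_mul_fderiv_eq_neg_fderiv_mul_of_integrable]
  · simp_rw [mul_comm]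
  · simpa only [mul_comm] using hi ψ φ
  · exact hi φ ψ
  · exact (φ.continuous.mul ψ.continuous).integrable_of_hasCompactSupport
      φ.hasCompactSupport.mul_right
  · exact fun x _ => φ.differentiable x
  · exact fun x _ => ψ.differentiable x

end TestFunction

/-- `u` belongs to `H¹₀(D)` with gradient `G`: the pair `(u, G)` is the limit in `L²(D)` of pairs
`(φ, ∇φ)` with `φ` a test function. -/
def H10Pair (D : TopologicalSpace.Opens (EuclideanSpace ℝ (Fin d)))
    (u : EuclideanSpace ℝ (Fin d) → ℝ)
    (G : EuclideanSpace ℝ (Fin d) → EuclideanSpace ℝ (Fin d)) : Prop :=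
  MemLp u 2 D.vol ∧ MemLp G 2 D.vol ∧ ∃ φ : ℕ → 𝓓(D, ℝ),
    Tendsto (fun n => eLpNorm (fun x => φ n x - u x) 2 D.vol) atTop (𝓝 0) ∧
    Tendsto (fun n => eLpNorm (fun x => gradient (φ n) x - G x) 2 D.vol) atTop (𝓝 0)

theorem MemH10.exists_h10Pair {u : EuclideanSpace ℝ (Fin d) → ℝ} (hu : MemH10 D u) :
    ∃ G, H10Pair D u G ∧ HasSobolevGradient D u G := by
  obtain ⟨G, hG, h⟩ := hu
  exact ⟨G, ⟨hG.1, hG.2.1, h⟩, hG⟩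

/-- By the fundamental lemma of the calculus of variations. It is needed because `MemH10` and
`OneAddLaplacianNonneg` each provide a gradient of their own. -/
theorem HasSobolevGradient.ae_eq {u : EuclideanSpace ℝ (Fin d) → ℝ}
    {G G' : EuclideanSpace ℝ (Fin d) → EuclideanSpace ℝ (Fin d)}
    (h : HasSobolevGradient D u G) (h' : HasSobolevGradient D u G') : G =ᵐ[D.vol] G' := by
  have hloc : LocallyIntegrableOn (fun x => G x - G' x) D volume :=
    locallyIntegrableOn_of_locallyIntegrable_restrict
      ((h.2.1.sub h'.2.1).locallyIntegrable one_le_two)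
  have hint : ∀ (φ : 𝓓(D, ℝ)) {H : EuclideanSpace ℝ (Fin d) → EuclideanSpace ℝ (Fin d)},
      MemLp H 2 D.vol → Integrable (fun x => φ x • H x) D.vol := fun φ H hH =>
    φ.memLp_two.integrable_bilin (ContinuousLinearMap.lsmul ℝ ℝ) hH
  have hz := D.isOpen.ae_eq_zero_of_integral_contDiff_smul_eq_zero hloc fun g hg hgc hgD => by
    let φ : 𝓓(D, ℝ) := ⟨g, hg, hgc, hgD⟩
    have e : ∫ x, φ x • G x ∂D.vol = ∫ x, φ x • G' x ∂D.vol :=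
      neg_injective ((h.2.2 φ).symm.trans (h'.2.2 φ))
    have e2 : ∫ x, φ x • (G x - G' x) ∂D.vol = 0 := by
      simp_rw [smul_sub]
      rw [integral_sub (hint φ h.2.1) (hint φ h'.2.1), e, sub_self]
    rw [← e2]
    refine (setIntegral_eq_integral_of_forall_compl_eq_zero fun x hx => ?_).symm
    rw [image_eq_zero_of_notMem_tsupport fun h => hx (hgD h), zero_smul]
  filter_upwards [(ae_restrict_iff' D.isOpen.measurableSet).2 hz] with x hx
  exact sub_eq_zero.1 hx

namespace H10Pair

open scoped ContDiff

variable {u v : EuclideanSpace ℝ (Fin d) → ℝ}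
  {G H : EuclideanSpace ℝ (Fin d) → EuclideanSpace ℝ (Fin d)}

/-- Both sides of the integration by parts for test functions are continuous in L², so the identity
passes to the limit. -/
theorem hasSobolevGradient (h : H10Pair D u G) : HasSobolevGradient D u G := by
  obtain ⟨hu, hG, φ, h1, h2⟩ := h
  refine ⟨hu, hG, fun ψ => ?_⟩
  have t1 := tendsto_integral_bilin (ContinuousLinearMap.lsmul ℝ ℝ) (fun n => (φ n).memLp_two) hu
    ψ.memLp_two_gradient h1
  have t2 := tendsto_integral_bilin (ContinuousLinearMap.lsmul ℝ ℝ).flip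
    (fun n => (φ n).memLp_two_gradient) hG ψ.memLp_two h2
  refine tendsto_nhds_unique (t1.congr fun n => ?_) t2.neg
  exact (φ n).integral_smul_gradient ψ

theorem memH10 (h : H10Pair D u G) : MemH10 D u := ⟨G, h.hasSobolevGradient, h.2.2⟩

theorem congr (h : H10Pair D u G) (huv : u =ᵐ[D.vol] v) (hGH : G =ᵐ[D.vol] H) :
    H10Pair D v H := by
  obtain ⟨hu, hG, φ, h1, h2⟩ := h
  refine ⟨hu.ae_eq huv, hG.ae_eq hGH, φ, h1.congr fun n => ?_, h2.congr fun n => ?_⟩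
  · exact eLpNorm_congr_ae (huv.mono fun x hx => by simp [hx])
  · exact eLpNorm_congr_ae (hGH.mono fun x hx => by simp [hx])

theorem add (hu : H10Pair D u G) (hv : H10Pair D v H) :
    H10Pair D (fun x => u x + v x) (fun x => G x + H x) := by
  obtain ⟨hu, hG, φ, h1, h2⟩ := hu
  obtain ⟨hv, hH, ψ, k1, k2⟩ := hv
  refine ⟨hu.add hv, hG.add hH, fun n => φ n + ψ n, ?_, ?_⟩
  · exact tendsto_eLpNorm_two_sub_add (fun n => (φ n).memLp_two) (fun n => (ψ n).memLp_two)
      hu hv h1 k1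
  · simp_rw [TestFunction.gradient_add]
    exact tendsto_eLpNorm_two_sub_add (fun n => (φ n).memLp_two_gradient)
      (fun n => (ψ n).memLp_two_gradient) hG hH h2 k2

theorem neg (hu : H10Pair D u G) : H10Pair D (fun x => -u x) (fun x => -G x) := by
  obtain ⟨hu, hG, φ, h1, h2⟩ := hu
  refine ⟨hu.neg, hG.neg, fun n => 0 - φ n, ?_, ?_⟩
  · refine h1.congr fun n => ?_
    rw [← eLpNorm_neg]
    congr 1
    ext x
    simp only [Pi.neg_apply, sub_apply, zero_apply]
    ring
  · refine h2.congr fun n => ?_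
    rw [← eLpNorm_neg]
    congr 1
    ext1 x
    have h0 : gradient (0 : 𝓓(D, ℝ)) x = 0 := by
      have : ((0 : 𝓓(D, ℝ)) : EuclideanSpace ℝ (Fin d) → ℝ) = fun _ => 0 := rfl
      rw [this]
      simp [gradient]
    rw [TestFunction.gradient_sub, h0, Pi.neg_apply, zero_sub, sub_neg_eq_add, neg_sub, neg_add_eq_sub]

theorem sub (hu : H10Pair D u G) (hv : H10Pair D v H) :
    H10Pair D (fun x => u x - v x) (fun x => G x - H x) := by
  simpa only [sub_eq_add_neg] using hu.add hv.neg

/-- The approximating test functions may be chosen to converge almost everywhere. -/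
theorem exists_tendsto_ae (h : H10Pair D u G) : ∃ φ : ℕ → 𝓓(D, ℝ),
    Tendsto (fun n => eLpNorm (fun x => φ n x - u x) 2 D.vol) atTop (𝓝 0) ∧
    Tendsto (fun n => eLpNorm (fun x => gradient (φ n) x - G x) 2 D.vol) atTop (𝓝 0) ∧
    ∀ᵐ x ∂D.vol, Tendsto (fun n => φ n x) atTop (𝓝 (u x)) := by
  obtain ⟨hu, hG, φ, h1, h2⟩ := h
  have hm : TendstoInMeasure D.vol (fun n => (φ n : EuclideanSpace ℝ (Fin d) → ℝ)) atTop u :=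
    tendstoInMeasure_of_tendsto_eLpNorm two_ne_zero (fun n => (φ n).memLp_two.1) hu.1 h1
  obtain ⟨ns, hns, hae⟩ := hm.exists_seq_tendsto_ae
  exact ⟨fun n => φ (ns n), h1.comp hns.tendsto_atTop, h2.comp hns.tendsto_atTop, hae⟩

/-- `H10Pair` is closed under convergence in `L²`. -/
theorem of_tendsto {U : ℕ → EuclideanSpace ℝ (Fin d) → ℝ}
    {V : ℕ → EuclideanSpace ℝ (Fin d) → EuclideanSpace ℝ (Fin d)}
    (h : ∀ k, H10Pair D (U k) (V k)) (hu : MemLp u 2 D.vol) (hG : MemLp G 2 D.vol)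
    (h1 : Tendsto (fun k => eLpNorm (fun x => U k x - u x) 2 D.vol) atTop (𝓝 0))
    (h2 : Tendsto (fun k => eLpNorm (fun x => V k x - G x) 2 D.vol) atTop (𝓝 0)) :
    H10Pair D u G := by
  have hex : ∀ k : ℕ, ∃ φ : 𝓓(D, ℝ),
      eLpNorm (fun x => φ x - U k x) 2 D.vol < ((k : ENNReal))⁻¹ ∧
      eLpNorm (fun x => gradient φ x - V k x) 2 D.vol < ((k : ENNReal))⁻¹ := by
    intro k
    obtain ⟨_, _, φ, k1, k2⟩ := h k
    -- For `k = 0` the tolerance is ∞, which is harmless.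
    have hpos : 0 < ((k : ENNReal))⁻¹ := ENNReal.inv_pos.2 (ENNReal.natCast_ne_top k)
    obtain ⟨n, hn⟩ := ((k1.eventually (gt_mem_nhds hpos)).and
      (k2.eventually (gt_mem_nhds hpos))).exists
    exact ⟨φ n, hn⟩
  choose φ k1 k2 using hex
  refine ⟨hu, hG, φ, ?_, ?_⟩
  · refine tendsto_eLpNorm_two_sub_trans (fun n => (φ n).memLp_two) (fun n => (h n).1) hu ?_ h1
    exact tendsto_of_tendsto_of_tendsto_of_le_of_le tendsto_const_nhds
      ENNReal.tendsto_inv_nat_nhds_zero (fun _ => zero_le) fun n => (k1 n).le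
  · refine tendsto_eLpNorm_two_sub_trans (fun n => (φ n).memLp_two_gradient) (fun n => (h n).2.1)
      hG ?_ h2
    exact tendsto_of_tendsto_of_tendsto_of_le_of_le tendsto_const_nhds
      ENNReal.tendsto_inv_nat_nhds_zero (fun _ => zero_le) fun n => (k2 n).le

/-- Chain rule in `H¹₀(D)` for smooth functions with derivative bounded by `1`. -/
theorem comp (h : H10Pair D u G) {f : ℝ → ℝ} (hf : ContDiff ℝ ∞ f) (h0 : f 0 = 0)
    (h1 : ∀ t, ‖deriv f t‖ ≤ 1) :
    H10Pair D (fun x => f (u x)) (fun x => deriv f (u x) • G x) := by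
  obtain ⟨φ, k1, k2, k3⟩ := h.exists_tendsto_ae
  obtain ⟨hu, hG, -⟩ := h
  have hlip := norm_sub_le_of_norm_deriv_le_one (hf.differentiable (by simp)) h1
  have hcont : Continuous (deriv f) := hf.continuous_deriv (by simp)
  have hfu : MemLp (fun x => f (u x)) 2 D.vol :=
    hu.of_le (hf.continuous.comp_aestronglyMeasurable hu.1)
      (Eventually.of_forall fun x => by simpa [h0] using hlip (u x) 0)
  have hsm : ∀ {w : EuclideanSpace ℝ (Fin d) → ℝ}, AEStronglyMeasurable w D.vol →
      MemLp (fun x => deriv f (w x) • G x) 2 D.vol := fun {w} hw =>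
    hG.of_le ((hcont.comp_aestronglyMeasurable hw).smul hG.1)
      (Eventually.of_forall fun x => by
        rw [norm_smul]
        exact mul_le_of_le_one_left (norm_nonneg _) (h1 _))
  refine ⟨hfu, hsm hu.1, fun n => (φ n).smoothComp f hf h0, ?_, ?_⟩
  · exact tendsto_eLpNorm_two_of_norm_le_mul (C := 1)
      (fun n x => by simpa using hlip (φ n x) (u x)) k1
  -- The intermediate field f'(φₙ) G separates two errors: ∇φₙ - G times a bounded factor, and the
  -- change of f'(φₙ) against the fixed G, handled by dominated convergence.
  · refine tendsto_eLpNorm_two_sub_trans (g := fun n x => deriv f (φ n x) • G x)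
      (fun n => (TestFunction.memLp_two_gradient _)) (fun n => hsm (φ n).memLp_two.1)
      (hsm hu.1) ?_ ?_
    · refine tendsto_eLpNorm_two_of_norm_le_mul (C := 1) (fun n x => ?_) k2
      rw [TestFunction.gradient_smoothComp, ← smul_sub, norm_smul]
      exact mul_le_mul_of_nonneg_right (h1 _) (norm_nonneg _)
    · refine tendsto_eLpNorm_two_sub_of_dominated (fun n => (hsm (φ n).memLp_two.1).1) hG
        (fun n x => ?_) ?_
      · rw [norm_smul]
        exact mul_le_of_le_one_left (norm_nonneg _) (h1 _)
      · filter_upwards [k3] with x hx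
        exact ((hcont.tendsto _).comp hx).smul_const _

theorem memLp_indicator_smul (hu : MemLp u 2 D.vol) (hG : MemLp G 2 D.vol) :
    MemLp (fun x => (if 0 < u x then (1 : ℝ) else 0) • G x) 2 D.vol := by
  refine hG.of_le (AEStronglyMeasurable.smul (f := fun x => if 0 < u x then (1 : ℝ) else 0) ?_ hG.1)
    (Eventually.of_forall fun x => ?_)
  · have : Measurable fun t : ℝ => if 0 < t then (1 : ℝ) else 0 :=
      Measurable.ite measurableSet_Ioi measurable_const measurable_const
    exact (this.comp_aemeasurable hu.1.aemeasurable).aestronglyMeasurable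
  · split_ifs <;> simp

/-- The positive part of a function of `H¹₀(D)`. -/
theorem posPart (h : H10Pair D u G) :
    H10Pair D (fun x => max (u x) 0) (fun x => (if 0 < u x then (1 : ℝ) else 0) • G x) := by
  have hd : ∀ k t, ‖deriv (smoothPosPart k) t‖ ≤ 1 := fun k t => by
    rw [deriv_smoothPosPart]
    exact norm_smoothStep_le_one k t
  have hk := fun k => h.comp (contDiff_smoothPosPart k) (smoothPosPart_zero k) (hd k)
  simp_rw [deriv_smoothPosPart] at hk
  refine of_tendsto hk ?_ (memLp_indicator_smul h.1 h.2.1) ?_ ?_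
  · exact h.1.sup (MemLp.zero' (ε := ℝ))
  · refine tendsto_eLpNorm_two_sub_of_dominated (fun k => (hk k).1.1) h.1 (fun k x => ?_)
      (Eventually.of_forall fun x => tendsto_smoothPosPart _)
    simpa [smoothPosPart_zero] using norm_sub_le_of_norm_deriv_le_one
      ((contDiff_smoothPosPart k).differentiable (by simp)) (hd k) (u x) 0
  · refine tendsto_eLpNorm_two_sub_of_dominated (fun k => (hk k).2.1.1) h.2.1 (fun k x => ?_)
      (Eventually.of_forall fun x => (tendsto_smoothStep _).smul_const _)
    rw [norm_smul]
    exact mul_le_of_le_one_left (norm_nonneg _) (norm_smoothStep_le_one _ _)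

/-- The maximum of two functions of `H¹₀(D)`. -/
theorem max (hu : H10Pair D u G) (hv : H10Pair D v H) :
    H10Pair D (fun x => max (u x) (v x))
      (fun x => H x + (if 0 < u x - v x then (1 : ℝ) else 0) • (G x - H x)) := by
  -- max(u,v) = v + (u-v)⁺.
  refine (hv.add (hu.sub hv).posPart).congr (Eventually.of_forall fun x => ?_)
    EventuallyEq.rfl
  rcases le_total (u x) (v x) with h | h
  · simp [h]
  · simp [h]

end H10Pair

end Sobolev

/-! ### The maximum of two subsolutions. -/

section Subsolutions

open scoped ContDiff

variable {d : ℕ} {D : TopologicalSpace.Opens (EuclideanSpace ℝ (Fin d))}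
  {u v : EuclideanSpace ℝ (Fin d) → ℝ}
  {G H : EuclideanSpace ℝ (Fin d) → EuclideanSpace ℝ (Fin d)}

/-- `1 + div G ≥ 0` on `D` in the sense of distributions. -/
def OneAddDivNonneg (D : TopologicalSpace.Opens (EuclideanSpace ℝ (Fin d)))
    (G : EuclideanSpace ℝ (Fin d) → EuclideanSpace ℝ (Fin d)) : Prop :=
  ∀ φ : 𝓓(D, ℝ), (∀ x, 0 ≤ φ x) →
    0 ≤ (∫ x, φ x ∂D.vol) - ∫ x, inner ℝ (G x) (gradient φ x) ∂D.vol

theorem OneAddLaplacianNonneg.oneAddDivNonneg (h : OneAddLaplacianNonneg D u)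
    (hG : HasSobolevGradient D u G) : OneAddDivNonneg D G := by
  obtain ⟨G', hG', h⟩ := h
  intro φ hφ
  have e : ∫ x, inner ℝ (G x) (gradient φ x) ∂D.vol =
      ∫ x, inner ℝ (G' x) (gradient φ x) ∂D.vol :=
    integral_congr_ae ((hG.ae_eq hG').mono fun x hx => by simp only [hx])
  rw [e]
  exact h φ hφ

theorem TestFunction.integrable_inner_gradient (φ : 𝓓(D, ℝ)) (hG : MemLp G 2 D.vol) :
    Integrable (fun x => inner ℝ (G x) (gradient φ x)) D.vol :=
  hG.integrable_bilin (innerSL ℝ) φ.memLp_two_gradient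

theorem TestFunction.integrable_restrict (φ : 𝓓(D, ℝ)) : Integrable φ D.vol :=
  (φ.continuous.integrable_of_hasCompactSupport φ.hasCompactSupport).restrict

theorem tendsto_integral_inner_gradient
    {V : ℕ → EuclideanSpace ℝ (Fin d) → EuclideanSpace ℝ (Fin d)} (φ : 𝓓(D, ℝ))
    (hV : ∀ n, MemLp (V n) 2 D.vol) (hG : MemLp G 2 D.vol)
    (h : Tendsto (fun n => eLpNorm (fun x => V n x - G x) 2 D.vol) atTop (𝓝 0)) :
    Tendsto (fun n => ∫ x, inner ℝ (V n x) (gradient φ x) ∂D.vol) atTop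
      (𝓝 (∫ x, inner ℝ (G x) (gradient φ x) ∂D.vol)) :=
  tendsto_integral_bilin (innerSL ℝ) hV hG φ.memLp_two_gradient h

theorem MeasureTheory.MemLp.smul_of_norm_le_one {c : EuclideanSpace ℝ (Fin d) → ℝ}
    (hG : MemLp G 2 D.vol) (hc : AEStronglyMeasurable c D.vol) (h1 : ∀ x, ‖c x‖ ≤ 1) :
    MemLp (fun x => c x • G x) 2 D.vol :=
  hG.of_le (hc.smul hG.1) (Eventually.of_forall fun x => by
    rw [norm_smul]
    exact mul_le_of_le_one_left (norm_nonneg _) (h1 x))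

/-- A smooth increasing function `p` of `u - v` interpolates between the subsolutions `u` and
`v`: here `G = ∇u` and `H = ∇v`. -/
theorem OneAddDivNonneg.interpolate (hG : OneAddDivNonneg D G) (hH : OneAddDivNonneg D H)
    (hG2 : MemLp G 2 D.vol) (hH2 : MemLp H 2 D.vol) {z : EuclideanSpace ℝ (Fin d) → ℝ}
    (hz : H10Pair D z (fun x => G x - H x)) {p : ℝ → ℝ} (hp : ContDiff ℝ ∞ p)
    (hp0 : ∀ t, 0 ≤ p t) (hp1 : ∀ t, p t ≤ 1) (hmono : Monotone p) {C : ℝ}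
    (hC : ∀ t, ‖deriv p t‖ ≤ C) :
    OneAddDivNonneg D fun x => H x + p (z x) • (G x - H x) := by
  intro φ hφ
  obtain ⟨ψ, -, k2, k3⟩ := hz.exists_tendsto_ae
  set K : EuclideanSpace ℝ (Fin d) → EuclideanSpace ℝ (Fin d) := fun x => G x - H x with hK
  have hK2 : MemLp K 2 D.vol := hG2.sub hH2
  have hpn : ∀ t, ‖p t‖ ≤ 1 := fun t => by
    rw [Real.norm_of_nonneg (hp0 t)]
    exact hp1 t
  have hpc : Continuous p := hp.continuous
  have hpc' : Continuous (deriv p) := hp.continuous_deriv (by simp)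
  have hsm : ∀ {w : EuclideanSpace ℝ (Fin d) → ℝ}, AEStronglyMeasurable w D.vol →
      MemLp (fun x => p (w x) • K x) 2 D.vol := fun {w} hw =>
    hK2.smul_of_norm_le_one (hpc.comp_aestronglyMeasurable hw) fun x => hpn _
  -- φ p(z) need not be smooth, so z is replaced by its approximations ψₙ.
  let χ : ℕ → 𝓓(D, ℝ) := fun n => φ.mulSmooth (fun x => p (ψ n x)) (hp.comp (ψ n).contDiff)
  have hχ : ∀ n x, gradient (χ n) x =
      (φ x * deriv p (ψ n x)) • gradient (ψ n) x + p (ψ n x) • gradient φ x := fun n x => by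
    rw [TestFunction.gradient_mulSmooth,
      gradient_comp_apply (hp.differentiable (by simp) _) ((ψ n).differentiable x), smul_smul]
  -- The error made in replacing ∇ψₙ by K in ∇χₙ; it tends to 0 in L² because φ and p' are bounded.
  let R : ℕ → EuclideanSpace ℝ (Fin d) → EuclideanSpace ℝ (Fin d) := fun n x =>
    (φ x * deriv p (ψ n x)) • (gradient (ψ n) x - K x)
  obtain ⟨B, hB⟩ := φ.continuous.bounded_above_of_compact_support φ.hasCompactSupport
  have hRle : ∀ n x, ‖R n x‖ ≤ (B * C) * ‖gradient (ψ n) x - K x‖ := fun n x => by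
    rw [norm_smul, norm_mul]
    gcongr
    · exact (norm_nonneg _).trans (hB x)
    · exact hB x
    · exact hC _
  have hR2 : ∀ n, MemLp (R n) 2 D.vol := fun n =>
    ((ψ n).memLp_two_gradient.sub hK2).of_le_mul (c := B * C)
      ((φ.continuous.mul (hpc'.comp (ψ n).continuous)).aestronglyMeasurable.smul
        ((ψ n).memLp_two_gradient.sub hK2).1) (Eventually.of_forall (hRle n))
  have hR0 : Tendsto (fun n => eLpNorm (fun x => R n x - 0) 2 D.vol) atTop (𝓝 0) := by
    simpa using tendsto_eLpNorm_two_of_norm_le_mul hRle k2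
  have t1 : Tendsto (fun n => ∫ x, inner ℝ (R n x) (K x) ∂D.vol) atTop (𝓝 0) := by
    have t := tendsto_integral_bilin (innerSL ℝ) hR2 (MemLp.zero' (ε := EuclideanSpace ℝ (Fin d)))
      hK2 hR0
    simp only [map_zero, zero_apply, integral_zero] at t
    exact t
  have t2 := tendsto_integral_inner_gradient φ (fun n => hsm (ψ n).memLp_two.1) (hsm hz.1.1)
    (tendsto_eLpNorm_two_sub_of_dominated (fun n => (hsm (ψ n).memLp_two.1).1) hK2
      (fun n x => by
        rw [norm_smul]
        exact mul_le_of_le_one_left (norm_nonneg _) (hpn _))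
      (k3.mono fun x hx => ((hpc.tendsto _).comp hx).smul_const _))
  have hbound : ∀ n, (∫ x, inner ℝ (R n x) (K x) ∂D.vol) +
      (∫ x, inner ℝ (p (ψ n x) • K x) (gradient φ x) ∂D.vol) ≤
      (∫ x, φ x ∂D.vol) - ∫ x, inner ℝ (H x) (gradient φ x) ∂D.vol := by
    intro n
    -- Since 0 ≤ p ≤ 1, both χₙ and φ - χₙ are nonnegative test functions.
    have i1 := hG (χ n) fun x => mul_nonneg (hφ x) (hp0 _)
    have i2 := hH (φ - χ n) fun x => by
      rw [sub_apply, TestFunction.mulSmooth_apply]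
      nlinarith [hφ x, hp1 (ψ n x)]
    simp_rw [TestFunction.gradient_sub, sub_apply, inner_sub_right] at i2
    rw [integral_sub φ.integrable_restrict (χ n).integrable_restrict,
      integral_sub (φ.integrable_inner_gradient hH2) ((χ n).integrable_inner_gradient hH2)] at i2
    have i3 : ∫ x, inner ℝ (K x) (gradient (χ n) x) ∂D.vol =
        (∫ x, inner ℝ (G x) (gradient (χ n) x) ∂D.vol) -
          ∫ x, inner ℝ (H x) (gradient (χ n) x) ∂D.vol := by
      simp_rw [hK, inner_sub_left]
      exact integral_sub ((χ n).integrable_inner_gradient hG2)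
        ((χ n).integrable_inner_gradient hH2)
    -- K·∇χₙ = Rₙ·K + p(ψₙ) K·∇φ + φ p'(ψₙ) |K|², and the last term is nonnegative by monotonicity
    -- of p.
    have i4 : (∫ x, inner ℝ (R n x) (K x) ∂D.vol) +
        (∫ x, inner ℝ (p (ψ n x) • K x) (gradient φ x) ∂D.vol) ≤
        ∫ x, inner ℝ (K x) (gradient (χ n) x) ∂D.vol := by
      have j1 : Integrable (fun x => inner ℝ (R n x) (K x)) D.vol :=
        (hR2 n).integrable_bilin (innerSL ℝ) hK2
      have j2 := φ.integrable_inner_gradient (hsm (ψ n).memLp_two.1)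
      rw [← integral_add j1 j2]
      refine integral_mono (j1.add j2) ((χ n).integrable_inner_gradient hK2) fun x => ?_
      have hpos : 0 ≤ φ x * deriv p (ψ n x) * inner ℝ (K x) (K x) :=
        mul_nonneg (mul_nonneg (hφ x) (hmono.deriv_nonneg)) real_inner_self_nonneg
      simp only [R, hχ, inner_smul_left, inner_smul_right, inner_add_right, inner_sub_left,
        real_inner_comm (K x) (gradient (ψ n) x), RCLike.conj_to_real]
      linarith
    linarith
  have hlim := le_of_tendsto' (t1.add t2) hbound
  simp_rw [inner_add_left]
  rw [integral_add (φ.integrable_inner_gradient hH2)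
    (φ.integrable_inner_gradient (hsm hz.1.1))]
  linarith

/-- The maximum of two subsolutions is a subsolution: here `G = ∇u` and `H = ∇v`. -/
theorem OneAddDivNonneg.max (hG : OneAddDivNonneg D G) (hH : OneAddDivNonneg D H)
    (hu : H10Pair D u G) (hv : H10Pair D v H) :
    OneAddDivNonneg D fun x =>
      H x + (if 0 < u x - v x then (1 : ℝ) else 0) • (G x - H x) := by
  have hz := hu.sub hv
  intro φ hφ
  have hsm : ∀ k, MemLp (fun x => smoothStep k (u x - v x) • (G x - H x)) 2 D.vol := fun k =>
    hz.2.1.smul_of_norm_le_one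
      ((contDiff_smoothStep k).continuous.comp_aestronglyMeasurable hz.1.1)
      fun x => norm_smoothStep_le_one _ _
  have hlim := tendsto_integral_inner_gradient φ hsm
    (H10Pair.memLp_indicator_smul hz.1 hz.2.1)
    (tendsto_eLpNorm_two_sub_of_dominated (fun k => (hsm k).1) hz.2.1
      (fun k x => by
        rw [norm_smul]
        exact mul_le_of_le_one_left (norm_nonneg _) (norm_smoothStep_le_one _ _))
      (Eventually.of_forall fun x => (tendsto_smoothStep _).smul_const _))
  have hk : ∀ k, (∫ x, inner ℝ (smoothStep k (u x - v x) • (G x - H x)) (gradient φ x) ∂D.vol) ≤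
      (∫ x, φ x ∂D.vol) - ∫ x, inner ℝ (H x) (gradient φ x) ∂D.vol := by
    intro k
    obtain ⟨C, hC⟩ := exists_deriv_smoothStep_le k
    have h := hG.interpolate hH hu.2.1 hv.2.1 hz (contDiff_smoothStep k) (smoothStep_nonneg k)
      (smoothStep_le_one k) (monotone_smoothStep k) hC φ hφ
    simp_rw [inner_add_left] at h
    rw [integral_add (φ.integrable_inner_gradient hv.2.1)
      (φ.integrable_inner_gradient (hsm k))] at h
    linarith
  have h := le_of_tendsto' hlim hk
  simp_rw [inner_add_left]
  rw [integral_add (φ.integrable_inner_gradient hv.2.1)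
    (φ.integrable_inner_gradient (H10Pair.memLp_indicator_smul hz.1 hz.2.1))]
  linarith

/-- The admissible set is closed under pointwise maxima. -/
theorem sup_mem_admissibleSet {a b : Lp ℝ 2 D.vol} (ha : a ∈ admissibleSet D)
    (hb : b ∈ admissibleSet D) : a ⊔ b ∈ admissibleSet D := by
  obtain ⟨ha1, ha2, ha3⟩ := ha
  obtain ⟨hb1, -, hb3⟩ := hb
  obtain ⟨G, hG, hG'⟩ := ha1.exists_h10Pair
  obtain ⟨H, hH, hH'⟩ := hb1.exists_h10Pair
  have hsup := Lp.coeFn_sup a b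
  have hmax := (hG.max hH).congr (v := ⇑(a ⊔ b)) hsup.symm EventuallyEq.rfl
  refine ⟨hmax.memH10, ?_, _, hmax.hasSobolevGradient,
    (ha3.oneAddDivNonneg hG').max (hb3.oneAddDivNonneg hH') hG hH⟩
  filter_upwards [hsup, ha2] with x hx h0
  rw [hx]
  exact le_sup_of_le_left h0

end Subsolutions

/-! ### Monotonicity of the discrete solutions. -/

section EulerScheme

/-- In `L²`, replacing `b` by `a ⊔ b` strictly decreases the distance to `a` unless `a ≤ b`. -/
theorem le_of_dist_le_dist_sup {α : Type*} [MeasurableSpace α] {μ : Measure α} {a b : Lp ℝ 2 μ}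
    (h : dist b a ≤ dist (a ⊔ b) a) : a ≤ b := by
  -- At almost every point the maximum equals `a` or `b`, so one factor vanishes.
  have horth : inner ℝ ((a ⊔ b) - a) ((a ⊔ b) - b) = 0 := by
    rw [L2.inner_def]
    refine integral_eq_zero_of_ae ?_
    filter_upwards [Lp.coeFn_sub (a ⊔ b) a, Lp.coeFn_sub (a ⊔ b) b, Lp.coeFn_sup a b]
      with x h1 h2 h3
    rw [h1, h2, Pi.sub_apply, Pi.sub_apply, h3, Pi.sup_apply]
    rcases le_total (a x) (b x) with hab | hab <;> simp [hab]
  have hsq : ‖b - a‖ * ‖b - a‖ = ‖(a ⊔ b) - a‖ * ‖(a ⊔ b) - a‖ +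
      ‖(a ⊔ b) - b‖ * ‖(a ⊔ b) - b‖ := by
    rw [← norm_sub_sq_eq_norm_sq_add_norm_sq_real horth, sub_sub_sub_cancel_left]
  rw [dist_eq_norm, dist_eq_norm] at h
  have h0 : ‖(a ⊔ b) - b‖ = 0 := by
    nlinarith [norm_nonneg (b - a), norm_nonneg ((a ⊔ b) - a), norm_nonneg ((a ⊔ b) - b)]
  rw [← sub_eq_zero.1 (norm_eq_zero.1 h0)]
  exact le_sup_left

/-- Cancels the common value of `J` from the minimality inequality; this is where its finiteness is
used. -/
theorem EReal.le_of_add_coe_le_add_coe {x : EReal} (hbot : x ≠ ⊥) (htop : x ≠ ⊤) {r s : ℝ}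
    (h : x + r ≤ x + s) : r ≤ s := by
  lift x to ℝ using ⟨htop, hbot⟩
  have h' : x + r ≤ x + s := by exact_mod_cast h
  linarith

variable {d : ℕ} {D : TopologicalSpace.Opens (EuclideanSpace ℝ (Fin d))}

/-- Discrete solutions of the Euler scheme of a proper decreasing functional are increasing. -/
theorem IsEulerScheme.monotone {J : admissibleSet D → EReal} (hJ_bot : ∀ w, J w ≠ ⊥)
    (hJ_proper : ∃ w, J w ≠ ⊤)
    (hJ : ∀ w₁ w₂ : admissibleSet D, (w₁ : Lp ℝ 2 D.vol) ≤ w₂ → J w₂ ≤ J w₁)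
    {ε : ℝ} (hε : 0 < ε) {w₀ : admissibleSet D} {w : ℕ → admissibleSet D}
    (hw : IsEulerScheme J ε w₀ w) : Monotone fun n => (w n : Lp ℝ 2 D.vol) := by
  refine monotone_nat_of_le_succ fun n => le_of_dist_le_dist_sup ?_
  obtain ⟨v, hv⟩ := hJ_proper
  -- An infinite value would lose to a competitor `v` with `J v` finite.
  have hfin : J (w (n + 1)) ≠ ⊤ := by
    intro htop
    have h := hw.2 n v
    rw [htop, EReal.top_add_coe, top_le_iff] at h
    exact EReal.add_ne_top hv (EReal.coe_ne_top _) h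
  let s : admissibleSet D := ⟨_, sup_mem_admissibleSet (w n).2 (w (n + 1)).2⟩
  have hs : J s ≤ J (w (n + 1)) := hJ _ _ le_sup_right
  have h := EReal.le_of_add_coe_le_add_coe (hJ_bot _) hfin
    ((hw.2 n s).trans (add_le_add_left hs _))
  rw [div_le_div_iff_of_pos_right (by positivity)] at h
  exact le_of_sq_le_sq h dist_nonneg

end EulerScheme

/-! ### Passage to the limit in the time step. -/

theorem theorem3p1 {d : ℕ} (D : TopologicalSpace.Opens (EuclideanSpace ℝ (Fin d)))
    (hD : Bornology.IsBounded (D : Set (EuclideanSpace ℝ (Fin d))))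
    (J : admissibleSet D → EReal)
    (hJ_bot : ∀ w, J w ≠ ⊥)
    (hJ_proper : ∃ w, J w ≠ ⊤)
    (hJ_decreasing : ∀ w₁ w₂ : admissibleSet D,
      (∀ᵐ x ∂(volume.restrict (D : Set (EuclideanSpace ℝ (Fin d)))),
        (w₁ : Lp ℝ 2 (volume.restrict (D : Set (EuclideanSpace ℝ (Fin d))))) x ≤
          (w₂ : Lp ℝ 2 (volume.restrict (D : Set (EuclideanSpace ℝ (Fin d))))) x) →
      J w₂ ≤ J w₁)
    (w₀ : admissibleSet D) (T : ℝ)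
    (w : Set.Icc (0 : ℝ) T → admissibleSet D) (hw : w ∈ GMM J w₀ T)
    (t₁ t₂ : Set.Icc (0 : ℝ) T) (ht : t₁ < t₂) :
    ∀ᵐ x ∂(volume.restrict (D : Set (EuclideanSpace ℝ (Fin d)))),
      (w t₁ : Lp ℝ 2 (volume.restrict (D : Set (EuclideanSpace ℝ (Fin d))))) x ≤
        (w t₂ : Lp ℝ 2 (volume.restrict (D : Set (EuclideanSpace ℝ (Fin d))))) x := by
  obtain ⟨ε, hε, -, e, he, hlim⟩ := hw
  refine (Lp.coeFn_le _ _).2 ?_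
  have hconv := fun t => (continuous_subtype_val.tendsto _).comp (hlim t)
  -- The order of L² is closed, so it suffices to compare the discrete solutions for each `k`.
  refine le_of_tendsto_of_tendsto' (hconv t₁) (hconv t₂) fun k => ?_
  refine (he k).monotone hJ_bot hJ_proper
    (fun w₁ w₂ h => hJ_decreasing w₁ w₂ ((Lp.coeFn_le _ _).2 h)) (hε k) ?_
  exact Nat.floor_mono (div_le_div_of_nonneg_right ht.le (hε k).le)
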